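/- For integers $n,d,k\ge 0$, let $F_{n,d}$ denote the vector space of real forms (homogeneous polynomials, including $0$) of degree $d$ in $n$ variables, let $F_{n,d}^k\subset F_{n,d}$ denote the set of those forms having at most $k$ terms (i.e. at most $k$ monomials with nonzero coefficient), and let \[ \Sigma_{n,2d}^k=\Bigl\{\sum_{j=1}^m h_j^2 \ \Big|\ m\in\mathbb N,\ h_j\in F_{n,d}^k\Bigr\}. \] Let $k\ge 1$ and let $h\in F_{n,d}^k\setminus F_{n,d}^{k-1}$, that is, $h$ is a real form of degree $d$ in $n$ variables with exactly $k$ terms. Suppose that either $h$ is indefinite (it takes both positive and negative values on $\mathbb R^n$) and irreducible in $\mathbb R[x_1,\dots,x_n]$, or $h$ is a product of real linear forms. Then \[ h^2\in\Sigma_{n,2d}^k\setminus\Sigma_{n,2d}^{k-1}. \] -/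

import Mathlib

open MvPolynomial

/-- `F_{n,d}`: the real vector space of real forms (homogeneous polynomials) of degree `d` in `n`
variables (together with `0`). -/
abbrev Forms (n d : ℕ) : Submodule ℝ (MvPolynomial (Fin n) ℝ) :=
  homogeneousSubmodule (Fin n) ℝ d

/-- `F_{n,d}^k`: the forms of degree `d` in `n` variables with at most `k` terms. -/
def FormsAtMost (n d k : ℕ) : Set (MvPolynomial (Fin n) ℝ) :=
  {p | p ∈ Forms n d ∧ p.support.card ≤ k}

/-- `Σ_{n,2d}^k`: the finite sums of squares of elements of `F_{n,d}^k`. The argument `d` is the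
degree of the forms that are squared, so the elements have degree `2d`. -/
def SigmaCone (n d k : ℕ) : Set (MvPolynomial (Fin n) ℝ) :=
  {f | ∃ (m : ℕ) (g : Fin m → MvPolynomial (Fin n) ℝ),
    (∀ j, g j ∈ FormsAtMost n d k) ∧ f = ∑ j, g j ^ 2}

/-- A real polynomial is indefinite if it takes both positive and negative values. -/
def IsIndefinite {n : ℕ} (p : MvPolynomial (Fin n) ℝ) : Prop :=
  (∃ x : Fin n → ℝ, 0 < eval x p) ∧ (∃ y : Fin n → ℝ, eval y p < 0)

/-- `p` is a finite product of real linear forms. -/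
def IsProductOfLinearForms {n : ℕ} (p : MvPolynomial (Fin n) ℝ) : Prop :=
  ∃ (m : ℕ) (l : Fin m → MvPolynomial (Fin n) ℝ), (∀ i, l i ∈ Forms n 1) ∧ p = ∏ i, l i

/-!
If `h ^ 2 = ∑ g j ^ 2`, every `g j` vanishes on the real zeros of `h`. An irreducible `p` that
changes sign divides every polynomial vanishing on its real zeros: otherwise, on lines in the
direction of the sign change, the resultant of the two polynomials is a nonzero polynomial in the
base point, yet by the intermediate value theorem it vanishes on an open set of base points.
Peeling off the irreducible factors of `h` one at a time gives `h ∣ g j`, so that `g j` is a scalar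
multiple of `h` for degree reasons, and hence is zero or has as many terms as `h`.
-/

section Resultant

variable {R : Type*} [CommRing R]

theorem resultant_ne_zero_of_irreducible_of_not_dvd [IsDomain R] [IsGCDMonoid R]
    {p q : Polynomial R} (hp : Irreducible p) (hdeg : p.natDegree ≠ 0) (hpq : ¬ p ∣ q) :
    p.resultant q ≠ 0 := by
  have hinj := FaithfulSMul.algebraMap_injective R (FractionRing R)
  have hprim : p.IsPrimitive := hp.isPrimitive hdeg
  have hcop : IsCoprime (p.map (algebraMap R (FractionRing R)))
      (q.map (algebraMap R (FractionRing R))) :=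
    (hprim.irreducible_iff_irreducible_map_fraction_map.1 hp).coprime_iff_not_dvd.2
      (mt hprim.dvd_of_fraction_map_dvd_fraction_map hpq)
  have hres := Polynomial.resultant_ne_zero _ _ hcop
  rw [Polynomial.natDegree_map_eq_of_injective hinj, Polynomial.natDegree_map_eq_of_injective hinj,
    Polynomial.resultant_map_map] at hres
  exact ne_zero_of_map hres

theorem resultant_eq_zero_of_isRoot {p q : Polynomial R} {m k : ℕ} (hp : p.natDegree ≤ m)
    (hq : q.natDegree ≤ k) (hm : m ≠ 0) {t : R} (hpt : p.IsRoot t) (hqt : q.IsRoot t) :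
    p.resultant q m k = 0 := by
  obtain ⟨u, v, -, -, huv⟩ := Polynomial.exists_mul_add_mul_eq_C_resultant p q hp hq (.inl hm)
  simpa [hpt.eq_zero, hqt.eq_zero] using (congrArg (Polynomial.eval t) huv).symm

end Resultant

section Shear

variable {σ R : Type*} [CommRing R]

/-- The restriction of a polynomial to lines of direction `v`: the substitution `x ↦ x + t v`, as a
polynomial in `t` whose coefficients are polynomials in the base point `x`. -/
noncomputable def lineSubst (v : σ → R) :
    MvPolynomial σ R →ₐ[R] Polynomial (MvPolynomial σ R) :=
  aeval fun i => Polynomial.C (X i) + Polynomial.C (C (v i)) * Polynomial.X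

theorem lineSubst_X (v : σ → R) (i : σ) :
    lineSubst v (X i) = Polynomial.C (X i) + Polynomial.C (C (v i)) * Polynomial.X :=
  aeval_X _ _

/-- The endomorphism `x ↦ x + t v`, `t ↦ t` of `R[x][t]`. It extends `lineSubst v` to an
automorphism, through which `lineSubst v` inherits the divisibility properties of the embedding of
`R[x]` into `R[x][t]`. -/
noncomputable def shear (v : σ → R) :
    Polynomial (MvPolynomial σ R) →ₐ[R] Polynomial (MvPolynomial σ R) :=
  Polynomial.aevalTower (lineSubst v) Polynomial.X

theorem shear_C (v : σ → R) (p : MvPolynomial σ R) :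
    shear v (Polynomial.C p) = lineSubst v p :=
  Polynomial.aevalTower_C _ _ _

theorem shear_X (v : σ → R) : shear v Polynomial.X = Polynomial.X :=
  Polynomial.aevalTower_X _ _

theorem shear_neg_comp_shear (v : σ → R) : (shear (-v)).comp (shear v) = AlgHom.id R _ := by
  refine Polynomial.algHom_ext' (MvPolynomial.algHom_ext fun i => ?_) ?_
  · simp [shear_C, shear_X, lineSubst_X, add_assoc, ← add_mul]
  · simp [shear_X]

/-- The automorphism `shear v` of `R[x][t]`, whose inverse is `shear (-v)`. -/
noncomputable def shearEquiv (v : σ → R) :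
    Polynomial (MvPolynomial σ R) ≃ₐ[R] Polynomial (MvPolynomial σ R) :=
  AlgEquiv.ofAlgHom (shear v) (shear (-v))
    (by simpa using shear_neg_comp_shear (-v)) (shear_neg_comp_shear v)

theorem shearEquiv_C (v : σ → R) (p : MvPolynomial σ R) :
    shearEquiv v (Polynomial.C p) = lineSubst v p :=
  shear_C v p

theorem prime_lineSubst_iff (v : σ → R) {p : MvPolynomial σ R} :
    Prime (lineSubst v p) ↔ Prime p := by
  rw [← shearEquiv_C, MulEquiv.prime_iff, Polynomial.prime_C_iff]

theorem lineSubst_dvd_lineSubst_iff (v : σ → R) {p q : MvPolynomial σ R} :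
    lineSubst v p ∣ lineSubst v q ↔ p ∣ q := by
  rw [← shearEquiv_C, ← shearEquiv_C, map_dvd_iff]
  exact ⟨fun h => by simpa using map_dvd Polynomial.constantCoeff h, map_dvd _⟩

theorem eval_map_lineSubst (v x : σ → R) (t : R) (p : MvPolynomial σ R) :
    ((lineSubst v p).map (eval x)).eval t = eval (x + t • v) p := by
  induction p using MvPolynomial.induction_on with
  | C r => simp [lineSubst, Polynomial.algebraMap_apply, MvPolynomial.algebraMap_eq]
  | add p q hp hq => simp [hp, hq]
  | mul_X p i hp => simp [hp, lineSubst_X, mul_comm t]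

theorem natDegree_lineSubst_ne_zero {v x : σ → R} {p : MvPolynomial σ R}
    (h : eval (x + v) p ≠ eval x p) : (lineSubst v p).natDegree ≠ 0 := by
  intro hdeg
  obtain ⟨c, hc⟩ := Polynomial.natDegree_eq_zero.1 hdeg
  have hconst (t : R) : eval (x + t • v) p = eval x c := by simp [← eval_map_lineSubst, ← hc]
  exact h (by simpa using (hconst 1).trans (hconst 0).symm)

end Shear

section SignChange

variable {σ : Type*}

theorem eq_zero_of_eventually_eval_eq_zero {p : MvPolynomial σ ℝ} {a : σ → ℝ}
    (h : ∀ᶠ x in nhds a, eval x p = 0) : p = 0 := by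
  rw [Filter.Eventually, nhds_pi, Filter.mem_pi] at h
  obtain ⟨I, -, s, hs, hsub⟩ := h
  refine funext_set s (fun i => infinite_of_mem_nhds (a i) (hs i)) fun x hx => ?_
  simpa using hsub fun i _ => hx i trivial

theorem eventually_exists_eval_add_smul_eq_zero {h : MvPolynomial σ ℝ} {a v : σ → ℝ}
    (ha : 0 < eval a h) (hav : eval (a + v) h < 0) :
    ∀ᶠ x in nhds a, ∃ t : ℝ, eval (x + t • v) h = 0 := by
  have hpos : ∀ᶠ x in nhds a, 0 < eval x h :=
    (continuous_eval h).continuousAt.eventually (lt_mem_nhds ha)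
  have hneg : ∀ᶠ x in nhds a, eval (x + v) h < 0 :=
    ((continuous_eval h).comp (continuous_add_const v)).continuousAt.eventually (gt_mem_nhds hav)
  filter_upwards [hpos, hneg] with x hx hxv
  have hcont : Continuous fun t : ℝ => eval (x + t • v) h :=
    (continuous_eval h).comp (by fun_prop)
  exact mem_range_of_exists_le_of_exists_ge hcont ⟨1, by simpa using hxv.le⟩
    ⟨0, by simpa using hx.le⟩

theorem dvd_of_forall_eval_eq_zero_of_sign_change {h g : MvPolynomial σ ℝ} (hirr : Irreducible h)
    {a b : σ → ℝ} (ha : 0 < eval a h) (hb : eval b h < 0)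
    (hg : ∀ x, eval x h = 0 → eval x g = 0) : h ∣ g := by
  obtain ⟨v, rfl⟩ : ∃ v, b = a + v := ⟨b - a, by simp⟩
  by_contra hndvd
  have hdeg : (lineSubst v h).natDegree ≠ 0 := natDegree_lineSubst_ne_zero (hb.trans ha).ne
  have hres : (lineSubst v h).resultant (lineSubst v g) ≠ 0 :=
    resultant_ne_zero_of_irreducible_of_not_dvd ((prime_lineSubst_iff v).2 hirr.prime).irreducible
      hdeg (mt (lineSubst_dvd_lineSubst_iff v).1 hndvd)
  refine hres (eq_zero_of_eventually_eval_eq_zero (a := a) ?_)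
  filter_upwards [eventually_exists_eval_add_smul_eq_zero ha hb] with x ⟨t, ht⟩
  rw [← Polynomial.resultant_map_map]
  exact resultant_eq_zero_of_isRoot Polynomial.natDegree_map_le Polynomial.natDegree_map_le hdeg
    ((eval_map_lineSubst v x t h).trans ht) ((eval_map_lineSubst v x t g).trans (hg _ ht))

end SignChange

section SumsOfSquares

variable {n : ℕ} {ι : Type*} [Fintype ι]

theorem IsIndefinite.dvd_of_dvd_sum_sq {p : MvPolynomial (Fin n) ℝ} (hind : IsIndefinite p)
    (hirr : Irreducible p) {g : ι → MvPolynomial (Fin n) ℝ} (hdvd : p ∣ ∑ j, g j ^ 2) (j : ι) :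
    p ∣ g j := by
  obtain ⟨⟨a, ha⟩, ⟨b, hb⟩⟩ := hind
  refine dvd_of_forall_eval_eq_zero_of_sign_change hirr ha hb fun x hx => ?_
  have hsum : ∑ j, eval x (g j) ^ 2 = 0 := by
    simpa [hx] using map_dvd (eval x) hdvd
  have hsq := (Finset.sum_eq_zero_iff_of_nonneg fun i _ => sq_nonneg _).1 hsum j (Finset.mem_univ j)
  exact pow_eq_zero_iff two_ne_zero |>.1 hsq

theorem dvd_of_sq_dvd_sum_sq {h : MvPolynomial (Fin n) ℝ} (h0 : h ≠ 0)
    (hfac : ∀ p, Irreducible p → p ∣ h → IsIndefinite p) {g : ι → MvPolynomial (Fin n) ℝ}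
    (hdvd : h ^ 2 ∣ ∑ j, g j ^ 2) (j : ι) : h ∣ g j := by
  induction h using WfDvdMonoid.induction_on_irreducible generalizing g with
  | zero => exact absurd rfl h0
  | unit u hu => exact hu.dvd
  | mul a p ha hp ih =>
    have hpg (j : ι) : p ∣ g j := (hfac p hp (dvd_mul_right p a)).dvd_of_dvd_sum_sq hp
      ((dvd_pow (dvd_mul_right p a) two_ne_zero).trans hdvd) j
    choose q hq using hpg
    obtain rfl : g = fun j => p * q j := funext hq
    simp only [mul_pow, ← Finset.mul_sum] at hdvd
    exact mul_dvd_mul_left p (ih ha (fun r hr hra => hfac r hr (hra.mul_left p))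
      ((mul_dvd_mul_iff_left (pow_ne_zero 2 hp.ne_zero)).1 hdvd))

end SumsOfSquares

section HomogeneousFactors

theorem support_eq_of_dvd_of_isHomogeneous {σ R : Type*} [CommRing R] [IsDomain R] {d : ℕ}
    {f g : MvPolynomial σ R} (hf : f.IsHomogeneous d) (hg : g.IsHomogeneous d) (hg0 : g ≠ 0)
    (hdvd : f ∣ g) : g.support = f.support := by
  obtain ⟨q, rfl⟩ := hdvd
  have hf0 := left_ne_zero_of_mul hg0
  have hq0 := right_ne_zero_of_mul hg0
  have hdeg := totalDegree_mul_of_isDomain hf0 hq0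
  rw [hg.totalDegree hg0, hf.totalDegree hf0] at hdeg
  obtain ⟨c, rfl⟩ : ∃ c, q = C c := ⟨_, totalDegree_eq_zero_iff_eq_C.1 (by lia)⟩
  rw [mul_comm, ← smul_eq_C_mul, support_smul_eq (by simpa using hq0)]

theorem irreducible_of_isHomogeneous_one {σ K : Type*} [Field K] {l : MvPolynomial σ K}
    (hl : l.IsHomogeneous 1) (h0 : l ≠ 0) : Irreducible l := by
  refine irreducible_of_totalDegree_eq_one (hl.totalDegree h0) fun c hc => ?_
  refine isUnit_iff_ne_zero.2 fun hc0 => h0 ?_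
  ext i
  simpa [hc0] using hc i

theorem eval_smul_of_isHomogeneous {σ R : Type*} [CommSemiring R] {d : ℕ} {p : MvPolynomial σ R}
    (hp : p.IsHomogeneous d) (c : R) (x : σ → R) : eval (c • x) p = c ^ d * eval x p := by
  rw [eval_eq, eval_eq, Finset.mul_sum]
  refine Finset.sum_congr rfl fun e he => ?_
  simp only [Pi.smul_apply, smul_eq_mul, mul_pow, Finset.prod_mul_distrib,
    Finset.prod_pow_eq_pow_sum, ← hp.degree_eq_sum_deg_support he]
  ring

variable {n : ℕ}

theorem isIndefinite_of_isHomogeneous_of_odd {d : ℕ} (hd : Odd d) {p : MvPolynomial (Fin n) ℝ}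
    (hp : p.IsHomogeneous d) (h0 : p ≠ 0) : IsIndefinite p := by
  obtain ⟨x, hx⟩ : ∃ x, eval x p ≠ 0 := by
    by_contra! hall
    exact h0 (MvPolynomial.funext fun x => by simpa using hall x)
  have hneg : eval ((-1 : ℝ) • x) p = -eval x p := by
    simpa [hd.neg_one_pow] using eval_smul_of_isHomogeneous hp (-1) x
  rcases hx.lt_or_gt with hx | hx
  · exact ⟨⟨_, hneg ▸ neg_pos.2 hx⟩, ⟨x, hx⟩⟩
  · exact ⟨⟨x, hx⟩, ⟨_, hneg ▸ neg_lt_zero.2 hx⟩⟩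

theorem IsIndefinite.of_associated {p q : MvPolynomial (Fin n) ℝ} (hq : IsIndefinite q)
    (hpq : Associated p q) : IsIndefinite p := by
  obtain ⟨u, rfl⟩ := hpq
  obtain ⟨c, hc, hu⟩ := isUnit_iff_eq_C_of_isReduced.1 u.isUnit
  obtain ⟨⟨x, hx⟩, ⟨y, hy⟩⟩ := hq
  simp only [hu, map_mul, eval_C] at hx hy
  rcases hc.ne_zero.lt_or_gt with hc | hc
  · exact ⟨⟨y, pos_of_mul_neg_left hy hc.le⟩, ⟨x, neg_of_mul_pos_left hx hc.le⟩⟩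
  · exact ⟨⟨x, pos_of_mul_pos_left hx hc.le⟩, ⟨y, neg_of_mul_neg_left hy hc.le⟩⟩

theorem IsProductOfLinearForms.isIndefinite_of_irreducible_of_dvd
    {h p : MvPolynomial (Fin n) ℝ} (hprod : IsProductOfLinearForms h) (h0 : h ≠ 0)
    (hp : Irreducible p) (hdvd : p ∣ h) : IsIndefinite p := by
  obtain ⟨m, l, hl, rfl⟩ := hprod
  obtain ⟨i, hi, hpl⟩ := hp.prime.exists_mem_finset_dvd hdvd
  have hl0 : l i ≠ 0 := Finset.prod_ne_zero_iff.1 h0 i hi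
  exact (isIndefinite_of_isHomogeneous_of_odd odd_one (hl i) hl0).of_associated
    (hp.associated_of_dvd (irreducible_of_isHomogeneous_one (hl i) hl0) hpl)

end HomogeneousFactors

section SigmaCone

variable {n d k : ℕ} {h : MvPolynomial (Fin n) ℝ}

theorem sq_mem_sigmaCone (hh : h ∈ FormsAtMost n d k) : h ^ 2 ∈ SigmaCone n d k :=
  ⟨1, fun _ => h, fun _ => hh, by simp⟩

theorem sq_notMem_sigmaCone (hh : h ∈ Forms n d) (hcard : k < h.support.card)
    (hfac : ∀ p, Irreducible p → p ∣ h → IsIndefinite p) : h ^ 2 ∉ SigmaCone n d k := by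
  rintro ⟨m, g, hg, hsum⟩
  have h0 : h ≠ 0 := by
    rintro rfl
    simp at hcard
  have hdvd : ∀ j, h ∣ g j := dvd_of_sq_dvd_sum_sq h0 hfac hsum.dvd
  have hzero (j : Fin m) : g j = 0 := by
    by_contra hgj
    have hsupp := support_eq_of_dvd_of_isHomogeneous hh (hg j).1 hgj (hdvd j)
    exact hcard.not_ge (hsupp ▸ (hg j).2)
  exact pow_ne_zero 2 h0 (by simpa [hzero] using hsum)

theorem ne_zero_of_notMem_formsAtMost (hh : h ∉ FormsAtMost n d k) : h ≠ 0 := by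
  rintro rfl
  exact hh ⟨zero_mem _, by simp⟩

theorem lt_card_support_of_notMem_formsAtMost (hh : h ∈ Forms n d) (hk : h ∉ FormsAtMost n d k) :
    k < h.support.card :=
  not_le.1 fun hle => hk ⟨hh, hle⟩

end SigmaCone

theorem corollary1p4_general (n d k : ℕ) (h : MvPolynomial (Fin n) ℝ)
    (hh : h ∈ FormsAtMost n d k \ FormsAtMost n d (k - 1))
    (hfac : ∀ p, Irreducible p → p ∣ h → IsIndefinite p) :
    h ^ 2 ∈ SigmaCone n d k \ SigmaCone n d (k - 1) :=
  ⟨sq_mem_sigmaCone hh.1,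
    sq_notMem_sigmaCone hh.1.1 (lt_card_support_of_notMem_formsAtMost hh.1.1 hh.2) hfac⟩

theorem corollary1p4 (n d k : ℕ) (hk : 1 ≤ k) (h : MvPolynomial (Fin n) ℝ)
    (hh : h ∈ FormsAtMost n d k \ FormsAtMost n d (k - 1))
    (hcase : (IsIndefinite h ∧ Irreducible h) ∨ IsProductOfLinearForms h) :
    h ^ 2 ∈ SigmaCone n d k \ SigmaCone n d (k - 1) := by
  have h0 : h ≠ 0 := ne_zero_of_notMem_formsAtMost hh.2
  exact corollary1p4_general n d k h hh fun p hp hdvd => hcase.elim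
    (fun hind => hind.1.of_associated (hp.associated_of_dvd hind.2 hdvd))
    (fun hprod => hprod.isIndefinite_of_irreducible_of_dvd h0 hp hdvd)
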